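/- **Theorem (Semi-Riemannian matching).** Let $(M_1,g_1)$ and $(M_2,g_2)$ be smooth semi-Riemannian manifolds with nonempty boundaries $\partial M_1,\partial M_2$, both of dimension $n$ and with the same signature (index $\nu$). Let $\phi:\partial M_1\to\partial M_2$ be a smooth diffeomorphism, and let $M:=M_1\cup_\phi M_2$ be the adjunction space, i.e. the topological quotient of the disjoint union $M_1\sqcup M_2$ by the identification $x\sim\phi(x)$ for $x\in\partial M_1$, equipped with a smooth structure for which the canonical maps $j_i:M_i\to M$ are diffeomorphisms onto regular domains (smooth immersions that are topological embeddings and proper maps). Let $\Sigma:=j_1(\partial M_1)=j_2(\partial M_2)$. Let $\xi$ be a smooth section of $TM_1|_{\partial M_1}$ that is transversal, i.e. $\xi(p)\notin T_p\partial M_1$ for all $p\in\partial M_1$, and suppose that $\phi$ is a $\xi$-aligning isometry: for every $p\in\partial M_1$ and all $v,w\in T_p\partial M_1$, 1. $g_1(v,w)=g_2(d\phi_p v,d\phi_p w)$, 2. $g_1(\xi(p),v)=g_2(\eta,d\phi_p v)$, 3. $g_1(\xi(p),\xi(p))=g_2(\eta,\eta)$, where $\eta\in T_{\phi(p)}M_2$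 is the vector corresponding to $\xi(p)$ in the tangent space of $M$, i.e. $d(j_2)_{\phi(p)}\eta=d(j_1)_p\,\xi(p)$. Then there exists a unique locally Lipschitz continuous semi-Riemannian metric $g$ of index $\nu$ on $M$ that agrees with $g_i$ on $M_i$, i.e. $j_i^*g=g_i$ for $i=1,2$. Moreover, $g$ is smooth on $M\setminus\Sigma$. -/

import Mathlib

open Set
open scoped Manifold ContDiff

/-! ### Semi-Riemannian metrics on manifolds (possibly with boundary) -/

section Metric

variable {E : Type*} [NormedAddCommGroup E] [NormedSpace ℝ E]
  {H : Type*} [TopologicalSpace H]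

/-- A semi-Riemannian metric tensor of index `ν` on a manifold `M`, without any regularity
assumption: a field of symmetric non-degenerate bilinear forms on the tangent spaces all of which
have negative index of inertia `ν`.  Together with `dim M` the index determines the signature. -/
@[ext]
structure SemiRiemannianMetric (I : ModelWithCorners ℝ E H) (M : Type*) [TopologicalSpace M]
    [ChartedSpace H M] (ν : ℕ) where
  /-- the bilinear form on the tangent space at `x` -/
  form (x : M) : TangentSpace I x →L[ℝ] TangentSpace I x →L[ℝ] ℝ
  symm (x : M) (v w : TangentSpace I x) : form x v w = form x w v
  nondegenerate (x : M) (v : TangentSpace I x) (hv : ∀ w : TangentSpace I x, form x v w = 0) :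
    v = 0
  index_eq (x : M) :
    sigNeg (LinearMap.BilinMap.toQuadraticMap
      ((ContinuousLinearMap.coeLM ℝ).comp (form x).toLinearMap)) = ν

namespace SemiRiemannianMetric

variable {I : ModelWithCorners ℝ E H} {M : Type*} [TopologicalSpace M] [ChartedSpace H M]
  [IsManifold I ∞ M] {ν : ℕ}

/-- The metric is smooth on the set `s`, as a section of the bundle of bilinear forms on `TM`. -/
def SmoothOn (g : SemiRiemannianMetric I M ν) (s : Set M) : Prop :=
  ContMDiffOn I (I.prod 𝓘(ℝ, E →L[ℝ] E →L[ℝ] ℝ)) ∞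
    (fun x ↦ Bundle.TotalSpace.mk' (E →L[ℝ] E →L[ℝ] ℝ)
      (E := fun x : M ↦ TangentSpace I x →L[ℝ] TangentSpace I x →L[ℝ] ℝ) x (g.form x)) s

/-- The coordinate expression, as a function on `E`, of the metric in the chart around `x₀`. It is
meaningful on the target of this chart. -/
noncomputable def coordForm (g : SemiRiemannianMetric I M ν) (x₀ : M) (y : E) :
    E →L[ℝ] E →L[ℝ] ℝ :=
  (trivializationAt (E →L[ℝ] E →L[ℝ] ℝ)
    (fun x : M ↦ TangentSpace I x →L[ℝ] TangentSpace I x →L[ℝ] ℝ) x₀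
    ⟨(extChartAt I x₀).symm y, g.form ((extChartAt I x₀).symm y)⟩).2

/-- The metric is locally Lipschitz continuous: so is its coordinate expression in every chart. -/
def IsLocallyLipschitz (g : SemiRiemannianMetric I M ν) : Prop :=
  ∀ x₀ : M, LocallyLipschitzOn (extChartAt I x₀).target (g.coordForm x₀)

end SemiRiemannianMetric

/-- The metric `g` on `M'` agrees with `g₁` on `M`, where `M` is seen inside `M'` via `j`:
the pullback of `g` along `j` is `g₁`. -/
def SemiRiemannianMetric.AgreesVia {E' : Type*} [NormedAddCommGroup E'] [NormedSpace ℝ E']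
    {H' : Type*} [TopologicalSpace H'] {I : ModelWithCorners ℝ E H} {I' : ModelWithCorners ℝ E' H'}
    {M : Type*} [TopologicalSpace M] [ChartedSpace H M]
    {M' : Type*} [TopologicalSpace M'] [ChartedSpace H' M'] {ν ν' : ℕ}
    (g : SemiRiemannianMetric I' M' ν') (j : M → M') (g₁ : SemiRiemannianMetric I M ν) : Prop :=
  ∀ (p : M) (v w : TangentSpace I p),
    g.form (j p) (mfderiv I I' j p v) (mfderiv I I' j p w) = g₁.form p v w

end Metric

/-! ### Boundaries and their diffeomorphisms -/

section Boundary

variable {n : ℕ} [NeZero n]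
  {M : Type*} [TopologicalSpace M] [ChartedSpace (EuclideanHalfSpace n) M]
  {M₁ : Type*} [TopologicalSpace M₁] [ChartedSpace (EuclideanHalfSpace n) M₁]
  {M₂ : Type*} [TopologicalSpace M₂] [ChartedSpace (EuclideanHalfSpace n) M₂]

/-- The subspace `T_p ∂M` of `T_p M`, for `p ∈ ∂M`. The elements of `T_p M` are coordinate vectors
in the preferred chart at `p`; this chart takes values in the half space `0 ≤ x 0` and maps the
boundary of `M` into the hyperplane `x 0 = 0`. -/
noncomputable def boundaryTangentSpace (p : M) : Submodule ℝ (TangentSpace (𝓡∂ n) p) :=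
  LinearMap.ker (EuclideanSpace.proj (0 : Fin n) : EuclideanSpace ℝ (Fin n) →L[ℝ] ℝ).toLinearMap

/-- `φ` is a smooth diffeomorphism `∂M₁ → ∂M₂`. Only the values of `φ` on `∂M₁` and of `φ.symm`
on `∂M₂` matter. -/
structure IsBoundaryDiffeo (n : ℕ) [NeZero n]
    {M₁ : Type*} [TopologicalSpace M₁] [ChartedSpace (EuclideanHalfSpace n) M₁]
    {M₂ : Type*} [TopologicalSpace M₂] [ChartedSpace (EuclideanHalfSpace n) M₂]
    (φ : PartialEquiv M₁ M₂) : Prop where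
  source_eq : φ.source = (𝓡∂ n).boundary M₁
  target_eq : φ.target = (𝓡∂ n).boundary M₂
  contMDiffOn : ContMDiffOn (𝓡∂ n) (𝓡∂ n) ∞ φ ((𝓡∂ n).boundary M₁)
  contMDiffOn_symm : ContMDiffOn (𝓡∂ n) (𝓡∂ n) ∞ φ.symm ((𝓡∂ n).boundary M₂)

/-- `ξ` is a smooth section of `TM|_{∂M}` that is transversal, i.e. nowhere tangent to `∂M`. Only
the values of `ξ` on `∂M` matter. -/
structure IsTransversalField [IsManifold (𝓡∂ n) ∞ M] (ξ : ∀ p : M, TangentSpace (𝓡∂ n) p) :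
    Prop where
  contMDiffOn : ContMDiffOn (𝓡∂ n) (𝓡∂ n).tangent ∞
    (fun p ↦ (⟨p, ξ p⟩ : TangentBundle (𝓡∂ n) M)) ((𝓡∂ n).boundary M)
  transversal : ∀ p ∈ (𝓡∂ n).boundary M, ξ p ∉ boundaryTangentSpace p

end Boundary

/-! ### Adjunction spaces -/

section Adjunction

/-- The relation on the disjoint union generating the identification of `x ∈ φ.source`
with `φ x`. -/
def adjunctionRel {M₁ M₂ : Type*} (φ : PartialEquiv M₁ M₂) (a b : M₁ ⊕ M₂) : Prop :=
  ∃ x ∈ φ.source, a = Sum.inl x ∧ b = Sum.inr (φ x)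

/-- The adjunction space `M₁ ∪_φ M₂`: the quotient of the disjoint union of `M₁` and `M₂` by the
equivalence relation generated by `x ∼ φ x` for `x` in the source of `φ`. -/
def AdjunctionSpace {M₁ M₂ : Type*} (φ : PartialEquiv M₁ M₂) : Type _ :=
  Quot (adjunctionRel φ)

namespace AdjunctionSpace

/-- The quotient topology of the disjoint union topology. -/
instance instTopologicalSpace {M₁ M₂ : Type*} [TopologicalSpace M₁] [TopologicalSpace M₂]
    (φ : PartialEquiv M₁ M₂) : TopologicalSpace (AdjunctionSpace φ) :=
  inferInstanceAs (TopologicalSpace (Quot (adjunctionRel φ)))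

/-- The canonical map `M₁ → M₁ ∪_φ M₂`. -/
def inl {M₁ M₂ : Type*} (φ : PartialEquiv M₁ M₂) (x : M₁) : AdjunctionSpace φ :=
  Quot.mk _ (Sum.inl x)

/-- The canonical map `M₂ → M₁ ∪_φ M₂`. -/
def inr {M₁ M₂ : Type*} (φ : PartialEquiv M₁ M₂) (x : M₂) : AdjunctionSpace φ :=
  Quot.mk _ (Sum.inr x)

/-- The image `Σ` in `M₁ ∪_φ M₂` of the two identified subsets. -/
def seam {M₁ M₂ : Type*} (φ : PartialEquiv M₁ M₂) : Set (AdjunctionSpace φ) :=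
  inl φ '' φ.source

end AdjunctionSpace

variable {n : ℕ} [NeZero n]
  {M₁ : Type*} [TopologicalSpace M₁] [ChartedSpace (EuclideanHalfSpace n) M₁]
  {M₂ : Type*} [TopologicalSpace M₂] [ChartedSpace (EuclideanHalfSpace n) M₂]

/-- `j` is a diffeomorphism of the `n`-manifold with boundary `M` onto a regular domain in the
`n`-manifold `N`: a smooth immersion that is a topological embedding and a proper map. -/
structure IsRegularDomainEmbedding (n : ℕ) [NeZero n]
    {M : Type*} [TopologicalSpace M] [ChartedSpace (EuclideanHalfSpace n) M]
    {N : Type*} [TopologicalSpace N] [ChartedSpace (EuclideanSpace ℝ (Fin n)) N]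
    (j : M → N) : Prop where
  contMDiff : ContMDiff (𝓡∂ n) (𝓡 n) ∞ j
  injective_mfderiv : ∀ p : M, Function.Injective (mfderiv (𝓡∂ n) (𝓡 n) j p)
  isEmbedding : Topology.IsEmbedding j
  isProperMap : IsProperMap j

/-- The given smooth structure on `M₁ ∪_φ M₂` is one of those provided by attaching the manifolds
along their boundaries: both canonical maps are diffeomorphisms onto regular domains. (That the two
regular domains cover the space and meet exactly in their boundaries holds by construction.) -/
structure IsGluedSmoothStructure (φ : PartialEquiv M₁ M₂)
    [ChartedSpace (EuclideanSpace ℝ (Fin n)) (AdjunctionSpace φ)]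
    [IsManifold (𝓡 n) ∞ (AdjunctionSpace φ)] : Prop where
  inl : IsRegularDomainEmbedding n (AdjunctionSpace.inl φ)
  inr : IsRegularDomainEmbedding n (AdjunctionSpace.inr φ)

/-- `φ` is a `ξ`-aligning isometry from `∂M₁` to `∂M₂`.  For `p ∈ ∂M₁`, the vector `ξ p ∈ T_p M₁`
is viewed as a vector `η ∈ T_{φ p} M₂` by means of the tangent space of `M₁ ∪_φ M₂` at the common
image of `p` and `φ p`. On vectors tangent to the boundary, `mfderivWithin` is the differential
of `φ : ∂M₁ → ∂M₂`. -/
structure IsAligningIsometry [IsManifold (𝓡∂ n) ∞ M₁] {ν₁ ν₂ : ℕ}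
    (g₁ : SemiRiemannianMetric (𝓡∂ n) M₁ ν₁) (g₂ : SemiRiemannianMetric (𝓡∂ n) M₂ ν₂)
    (φ : PartialEquiv M₁ M₂) [ChartedSpace (EuclideanSpace ℝ (Fin n)) (AdjunctionSpace φ)]
    (ξ : ∀ p : M₁, TangentSpace (𝓡∂ n) p) : Prop where
  isTransversalField : IsTransversalField ξ
  isBoundaryDiffeo : IsBoundaryDiffeo n φ
  /-- `φ` maps the metric induced on `∂M₁` to the one induced on `∂M₂`. -/
  isometry : ∀ p ∈ (𝓡∂ n).boundary M₁, ∀ v ∈ boundaryTangentSpace p, ∀ w ∈ boundaryTangentSpace p,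
    g₁.form p v w =
      g₂.form (φ p) (mfderivWithin (𝓡∂ n) (𝓡∂ n) φ ((𝓡∂ n).boundary M₁) p v)
        (mfderivWithin (𝓡∂ n) (𝓡∂ n) φ ((𝓡∂ n).boundary M₁) p w)
  /-- `φ` maps the one-form `g₁(ξ, ·)` on `∂M₁` to `g₂(ξ, ·)`, and the function `g₁(ξ, ξ)`
  to `g₂(ξ, ξ)`. -/
  aligning : ∀ p ∈ (𝓡∂ n).boundary M₁, ∃ η : TangentSpace (𝓡∂ n) (φ p),
    tangentMap (𝓡∂ n) (𝓡 n) (AdjunctionSpace.inr φ) ⟨φ p, η⟩ =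
      tangentMap (𝓡∂ n) (𝓡 n) (AdjunctionSpace.inl φ) ⟨p, ξ p⟩ ∧
    (∀ v ∈ boundaryTangentSpace p, g₁.form p (ξ p) v =
      g₂.form (φ p) η (mfderivWithin (𝓡∂ n) (𝓡∂ n) φ ((𝓡∂ n).boundary M₁) p v)) ∧
    g₁.form p (ξ p) (ξ p) = g₂.form (φ p) η η

end Adjunction

/-! At each point of $M$ the value of $g$ is forced: a regular domain has full dimension, so $dj_i$
is an isomorphism at every point and carries $g_i$ to a form on the tangent space of $M$. This gives
uniqueness pointwise, and existence except on $\Sigma$, where two pushed-forward forms have to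
coincide. There $T_pM_1 = T_p\partial M_1 \oplus \mathbb{R}\xi(p)$. Since $j_1 = j_2 \circ \phi$ on
the boundary, $d\phi$ is compatible with $dj_1$ and $dj_2$ on boundary vectors, and conditions 1-3
say that the two forms agree on the blocks of this splitting (`form_eq_of_eq_on_hyperplane`,
`IsAligningIsometry.form_eq`).

For the regularity, let $f$ be $j_i$ read in charts. The components of $g$ composed with $f$ are
those of $g_i$ transformed by $(Df)^{-1}$, hence smooth up to the boundary
(`AgreesVia.exists_coordForm_comp_eq`). At an interior point $f$ is a local diffeomorphism, so $g$
is smooth. At a boundary point $f$ is still antilipschitz on a half ball, so $g$ is Lipschitz on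
each side. A segment joining the two sides crosses $\Sigma$, and the one-sided estimates add up
along it (`exists_lipschitzOnWith_of_closed_cover`). Nothing matches the derivatives of $g$ across
$\Sigma$, so Lipschitz is all that this gives there. -/

open Filter Topology

/-! ### Metrics and differentials in charts -/

section CoordForm

variable {E : Type*} [NormedAddCommGroup E] [NormedSpace ℝ E]
  {H : Type*} [TopologicalSpace H] {I : ModelWithCorners ℝ E H}
  {M : Type*} [TopologicalSpace M] [ChartedSpace H M] [IsManifold I ∞ M]
  {E' : Type*} [NormedAddCommGroup E'] [NormedSpace ℝ E']
  {H' : Type*} [TopologicalSpace H'] {I' : ModelWithCorners ℝ E' H'}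
  {M' : Type*} [TopologicalSpace M'] [ChartedSpace H' M'] [IsManifold I' ∞ M']
  {ν ν' : ℕ}

namespace SemiRiemannianMetric

/-- The bundle of forms is trivialized by precomposing with the inverse trivializations of the
tangent bundle, the target `ℝ` being trivial. -/
theorem coordForm_extChartAt (g : SemiRiemannianMetric I M ν) {x₀ x : M}
    (hx : x ∈ (chartAt H x₀).source) (u v : E) :
    g.coordForm x₀ (extChartAt I x₀ x) u v =
      g.form x ((trivializationAt E (TangentSpace I) x₀).symmL ℝ x u)
        ((trivializationAt E (TangentSpace I) x₀).symmL ℝ x v) := by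
  have h : (extChartAt I x₀).symm (extChartAt I x₀ x) = x :=
    (extChartAt I x₀).left_inv (by rwa [extChartAt_source])
  have hx' : x ∈ (trivializationAt E (TangentSpace I) x₀).baseSet := by
    simpa using hx
  unfold coordForm
  rw [h]
  rw [hom_trivializationAt_apply]
  refine (inCoordinates_apply_eq₂ hx' hx' (by simp)).trans ?_
  rw [Bundle.Trivialization.symmL_apply _ hx', Bundle.Trivialization.symmL_apply _ hx']
  simp

/-- Smoothness of the metric at a point is smoothness of its coordinate expression in the chart
around this point. -/
theorem contMDiffAt_form_iff (g : SemiRiemannianMetric I M ν) (x₀ : M) :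
    ContMDiffAt I (I.prod 𝓘(ℝ, E →L[ℝ] E →L[ℝ] ℝ)) ∞
      (fun x ↦ Bundle.TotalSpace.mk' (E →L[ℝ] E →L[ℝ] ℝ)
        (E := fun x : M ↦ TangentSpace I x →L[ℝ] TangentSpace I x →L[ℝ] ℝ) x (g.form x)) x₀ ↔
    ContDiffWithinAt ℝ ∞ (g.coordForm x₀) (range I) (extChartAt I x₀ x₀) := by
  rw [Bundle.contMDiffAt_section, contMDiffAt_iff_source, contMDiffWithinAt_iff_contDiffWithinAt]
  rfl

end SemiRiemannianMetric

/-- Chain rule: the tangent bundle is trivialized over a chart by the derivative of this chart. The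
points `x` and `j x` may vary in the domains of fixed charts, as is needed to treat the derivative
as a function. -/
theorem fderivWithin_extChartAt_comp {j : M → M'} {x₀ x : M} {y₀ : M'}
    (hj : MDifferentiableAt I I' j x) (hx : x ∈ (chartAt H x₀).source)
    (hy : j x ∈ (chartAt H' y₀).source) (u : E) :
    (trivializationAt E' (TangentSpace I') y₀).symmL ℝ (j x)
      (fderivWithin ℝ (extChartAt I' y₀ ∘ j ∘ (extChartAt I x₀).symm) (range I)
        (extChartAt I x₀ x) u) =
    mfderiv I I' j x ((trivializationAt E (TangentSpace I) x₀).symmL ℝ x u) := by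
  have h : (extChartAt I x₀).symm (extChartAt I x₀ x) = x :=
    (extChartAt I x₀).left_inv (by rwa [extChartAt_source])
  obtain ⟨D₁, hD₁⟩ : ∃ D : E →L[ℝ] E, D =
      mfderivWithin 𝓘(ℝ, E) I (extChartAt I x₀).symm (range I) (extChartAt I x₀ x) := ⟨_, rfl⟩
  obtain ⟨D₂, hD₂⟩ : ∃ D : E →L[ℝ] E', D = mfderiv I I' j x := ⟨_, rfl⟩
  obtain ⟨D₃, hD₃⟩ : ∃ D : E' →L[ℝ] E', D = mfderiv I' 𝓘(ℝ, E') (extChartAt I' y₀) (j x) :=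
    ⟨_, rfl⟩
  have h₁ : HasMFDerivWithinAt 𝓘(ℝ, E) I (extChartAt I x₀).symm (range I)
      (extChartAt I x₀ x) D₁ :=
    hD₁ ▸ (mdifferentiableWithinAt_extChartAt_symm
      ((extChartAt I x₀).map_source (by rwa [extChartAt_source]))).hasMFDerivWithinAt
  have h₂ : HasMFDerivAt I I' j ((extChartAt I x₀).symm (extChartAt I x₀ x)) D₂ := by
    rw [h]
    exact hD₂ ▸ hj.hasMFDerivAt
  have h₃ : HasMFDerivAt I' 𝓘(ℝ, E') (extChartAt I' y₀)
      (j ((extChartAt I x₀).symm (extChartAt I x₀ x))) D₃ := by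
    rw [h]
    exact hD₃ ▸ (mdifferentiableAt_extChartAt hy).hasMFDerivAt
  have h₄ : HasFDerivWithinAt (extChartAt I' y₀ ∘ j ∘ (extChartAt I x₀).symm)
      (D₃.comp (D₂.comp D₁)) (range I) (extChartAt I x₀ x) :=
    hasMFDerivWithinAt_iff_hasFDerivWithinAt.1
      (HasMFDerivAt.comp_hasMFDerivWithinAt (f := j ∘ (extChartAt I x₀).symm) _ h₃
        (h₂.comp_hasMFDerivWithinAt _ h₁))
  have e₁ : (trivializationAt E (TangentSpace I) x₀).symmL ℝ x u = D₁ u :=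
    hD₁ ▸ congr($(TangentBundle.symmL_trivializationAt (𝕜 := ℝ) (I := I) hx) u)
  have e₂ : (trivializationAt E' (TangentSpace I') y₀).continuousLinearMapAt ℝ (j x) = D₃ :=
    hD₃ ▸ TangentBundle.continuousLinearMapAt_trivializationAt (𝕜 := ℝ) (I := I') hy
  have e₃ := (trivializationAt E' (TangentSpace I') y₀).symmL_continuousLinearMapAt (R := ℝ)
    (b := j x) (by simpa using hy)
  have hu : UniqueDiffWithinAt ℝ (range I) (extChartAt I x₀ x) := I.uniqueDiffWithinAt_image
  rw [e₂] at e₃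
  rw [e₁, h₄.fderivWithin hu, ← hD₂]
  exact e₃ _

/-- The transformation law of the components of a metric, which turns agreement along `j` into an
identity between functions on the model space. -/
theorem SemiRiemannianMetric.AgreesVia.coordForm {g' : SemiRiemannianMetric I' M' ν'} {j : M → M'}
    {g : SemiRiemannianMetric I M ν} (h : g'.AgreesVia j g) {x₀ x : M} {y₀ : M'}
    (hj : MDifferentiableAt I I' j x) (hx : x ∈ (chartAt H x₀).source)
    (hy : j x ∈ (chartAt H' y₀).source) (u v : E) :
    g'.coordForm y₀ (extChartAt I' y₀ (j x))
      (fderivWithin ℝ (extChartAt I' y₀ ∘ j ∘ (extChartAt I x₀).symm) (range I)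
        (extChartAt I x₀ x) u)
      (fderivWithin ℝ (extChartAt I' y₀ ∘ j ∘ (extChartAt I x₀).symm) (range I)
        (extChartAt I x₀ x) v) =
    g.coordForm x₀ (extChartAt I x₀ x) u v := by
  rw [g'.coordForm_extChartAt hy, g.coordForm_extChartAt hx, fderivWithin_extChartAt_comp hj hx hy,
    fderivWithin_extChartAt_comp hj hx hy, h]

end CoordForm

/-! ### Lipschitz and smooth functions on normed spaces -/

section Euclidean

variable {E : Type*} [NormedAddCommGroup E] [NormedSpace ℝ E]
  {E' : Type*} [NormedAddCommGroup E'] [NormedSpace ℝ E']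
  {F : Type*} [NormedAddCommGroup F]

/-- A map which is `C^1` within a convex set and has an invertible derivative at a point of this
set is antilipschitz near this point within the set. -/
theorem ContDiffWithinAt.exists_antilipschitzWith_domRestrict   {f : E → E'} {S : Set E}
    {z : E} (hf : ContDiffWithinAt ℝ 1 f S z) (hS : Convex ℝ S) (hz : z ∈ S)
    (hS' : UniqueDiffWithinAt ℝ S z) {A : E ≃L[ℝ] E'} (hA : fderivWithin ℝ f S z = A) :
    ∃ K, ∃ t ∈ 𝓝[S] z, AntilipschitzWith K (t.domRestrict f) := by
  -- The difference `f - A` has zero derivative at `z`, so near `z` it is Lipschitz with any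
  -- constant `c > 0`. With `c < ‖A⁻¹‖⁻¹` it is too small a perturbation to destroy the lower bound
  -- on `A`.
  have hd : ContDiffWithinAt ℝ 1 (fun y ↦ f y - (A : E →L[ℝ] E') y) S z :=
    hf.sub A.contDiff.contDiffWithinAt
  obtain hE | hE := subsingleton_or_nontrivial E
  · exact ⟨0, S, self_mem_nhdsWithin, AntilipschitzWith.of_subsingleton⟩
  have hpos : 0 < ‖(A.symm : E' →L[ℝ] E)‖₊⁻¹ := by
    have := A.nnnorm_symm_pos
    positivity
  obtain ⟨c, hc0, hc⟩ := exists_between hpos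
  obtain ⟨u, hu, p, hp⟩ := hd 1 le_rfl
  rw [insert_eq_of_mem hz] at hu
  obtain ⟨ε, ε0, hε⟩ := Metric.mem_nhdsWithin_iff.mp hu
  have hz' : z ∈ Metric.ball z ε ∩ S := ⟨Metric.mem_ball_self ε0, hz⟩
  have hp' := hp.mono hε
  have h0 : p z 1 = 0 := by
    have h₁ := hp'.hasFDerivWithinAt one_ne_zero hz'
    have h₂ : HasFDerivWithinAt (fun y ↦ f y - (A : E →L[ℝ] E') y) (A - A : E →L[ℝ] E')
        (Metric.ball z ε ∩ S) z :=
      ((hA ▸ (hf.differentiableWithinAt one_ne_zero).hasFDerivWithinAt).sub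
        (A : E →L[ℝ] E').hasFDerivWithinAt).mono inter_subset_right
    -- The linear Taylor coefficient `p z 1` and `A - A` are both derivatives of `f - A` within the
    -- same set, so they coincide.
    have h₃ := UniqueDiffWithinAt.eq (inter_comm S _ ▸ hS'.inter (Metric.ball_mem_nhds z ε0)) h₁ h₂
    rwa [sub_self, map_eq_zero_iff _ (LinearIsometryEquiv.injective _)] at h₃
  rw [← insert_eq_of_mem hz'] at hp'
  obtain ⟨t, ht, hlip⟩ := hp'.exists_lipschitzOnWith_of_nnnorm_lt
    ((convex_ball z ε).inter hS) c (by simpa [h0] using hc0)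
  refine ⟨_, t, ?_, ApproximatesLinearOn.antilipschitz (f' := A) (c := c) ?_ (Or.inr hc)⟩
  · rwa [inter_comm, nhdsWithin_inter_of_mem'] at ht
    exact mem_nhdsWithin_of_mem_nhds (Metric.ball_mem_nhds _ ε0)
  · rw [ApproximatesLinearOn.approximatesLinearOn_iff_lipschitzOnWith]
    exact hlip

/-- If `G ∘ f` is `C^1` within a convex set at `z`, where `f` is `C^1` with an invertible
derivative, then `G` is Lipschitz on the images under `f` of small neighborhoods of `z`. -/
theorem exists_lipschitzOnWith_image [CompleteSpace E] [NormedSpace ℝ F]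
    {f : E → E'} {S : Set E} {z : E}
    {G : E' → F} {K : E → F}
    (hf : ContDiffWithinAt ℝ 1 f S z) (hS : Convex ℝ S) (hz : z ∈ S)
    (hS' : UniqueDiffWithinAt ℝ S z) {A : E ≃L[ℝ] E'} (hA : fderivWithin ℝ f S z = A)
    (hK : ContDiffWithinAt ℝ 1 K S z) (hG : ∀ᶠ y in 𝓝[S] z, G (f y) = K y) :
    ∃ C, ∃ t ∈ 𝓝[S] z, LipschitzOnWith C G (f '' t) := by
  obtain ⟨c, t, ht, hc⟩ := hf.exists_antilipschitzWith_domRestrict hS hz hS' hA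
  obtain ⟨k, s, hs, hk⟩ := hK.exists_lipschitzOnWith hS
  refine ⟨k * c, _, inter_mem (inter_mem ht hs) hG, ?_⟩
  rintro _ ⟨x, ⟨⟨hxt, hxs⟩, hx⟩, rfl⟩ _ ⟨y, ⟨⟨hyt, hys⟩, hy⟩, rfl⟩
  have h := hc ⟨x, hxt⟩ ⟨y, hyt⟩
  change G (f x) = K x at hx
  change G (f y) = K y at hy
  rw [hx, hy]
  calc edist (K x) (K y) ≤ k * edist x y := hk hxs hys
    _ ≤ k * (c * edist (f x) (f y)) := by gcongr; exact h
    _ = _ := by push_cast; ring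

/-- If `G ∘ f` is `C^m` at `z`, where `f` is `C^m` with an invertible derivative, then `G` is `C^m`
at `f z`. -/
theorem contDiffAt_of_comp [CompleteSpace E] [NormedSpace ℝ F] {f : E → E'} {z : E}
    {G : E' → F} {K : E → F}
    {m : WithTop ℕ∞} (hm : m ≠ 0) (hf : ContDiffAt ℝ m f z) {A : E ≃L[ℝ] E'}
    (hA : fderiv ℝ f z = A) (hK : ContDiffAt ℝ m K z) (hG : ∀ᶠ y in 𝓝 z, G (f y) = K y) :
    ContDiffAt ℝ m G (f z) := by
  have hA' : HasFDerivAt f (A : E →L[ℝ] E') z := hA ▸ (hf.differentiableAt hm).hasFDerivAt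
  have hs := hf.hasStrictFDerivAt' hA' hm
  have hl := hf.to_localInverse hA' hm
  have hz := hf.localInverse_apply_image hA' hm
  -- Near `f z` the function `G` coincides with `K ∘ f⁻¹`, where `f⁻¹` is the local inverse.
  have h₁ : ContDiffAt ℝ m (K ∘ hf.localInverse hA' hm) (f z) :=
    ContDiffAt.comp _ (by rwa [hz]) hl
  refine h₁.congr_of_eventuallyEq ?_
  have h₂ : ∀ᶠ y in 𝓝 (f z), f (hf.localInverse hA' hm y) = y := hs.eventually_right_inverse
  have h₃ := hl.continuousAt
  rw [ContinuousAt, hz] at h₃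
  filter_upwards [h₂, h₃.eventually hG] with y h h'
  rw [h] at h'
  exact h'

/-- If a neighborhood of a point is covered by two relatively closed sets on each of which a function
is Lipschitz near this point, then the function is Lipschitz near this point. -/
theorem exists_lipschitzOnWith_of_closed_cover {G : E → F} {A₁ A₂ U : Set E} {y : E}
    (hU : U ∈ 𝓝 y) (hc : U ⊆ A₁ ∪ A₂)
    (h₁ : ∃ V, IsClosed V ∧ V ∩ U = A₁ ∩ U) (h₂ : ∃ V, IsClosed V ∧ V ∩ U = A₂ ∩ U)
    (hG₁ : ∃ C, ∃ t ∈ 𝓝[A₁] y, LipschitzOnWith C G t)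
    (hG₂ : ∃ C, ∃ t ∈ 𝓝[A₂] y, LipschitzOnWith C G t) :
    ∃ C, ∃ t ∈ 𝓝 y, LipschitzOnWith C G t := by
  obtain ⟨V₁, hV₁, hVU₁⟩ := h₁
  obtain ⟨V₂, hV₂, hVU₂⟩ := h₂
  obtain ⟨C₁, t₁, ht₁, hG₁⟩ := hG₁
  obtain ⟨C₂, t₂, ht₂, hG₂⟩ := hG₂
  rw [mem_nhdsWithin_iff_eventually] at ht₁ ht₂
  obtain ⟨ε, ε0, hε⟩ := Metric.eventually_nhds_iff_ball.1 ((ht₁.and ht₂).and hU)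
  -- The segment from `a` to `b` is connected and covered by two closed sets, so it contains a point
  -- `w` of both. The increment of `G` is split at `w`; distances add up along the segment, so no
  -- constant is lost.
  have key : ∀ a ∈ Metric.ball y ε, ∀ b ∈ Metric.ball y ε, a ∈ A₁ → b ∈ A₂ →
      edist (G a) (G b) ≤ (max C₁ C₂ : NNReal) * edist a b := by
    intro a ha b hb haA hbA
    have hseg : segment ℝ a b ⊆ Metric.ball y ε := (convex_ball y ε).segment_subset ha hb
    obtain ⟨w, hw, hw₁, hw₂⟩ : (segment ℝ a b ∩ (V₁ ∩ V₂)).Nonempty := by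
      refine (isPreconnected_closed_iff.1 (convex_segment a b).isPreconnected) V₁ V₂ hV₁ hV₂ ?_
        ⟨a, left_mem_segment ℝ a b, ?_⟩ ⟨b, right_mem_segment ℝ a b, ?_⟩
      · intro x hx
        have hxU := (hε x (hseg hx)).2
        refine (hc hxU).imp (fun h ↦ ?_) (fun h ↦ ?_)
        · exact (hVU₁.ge ⟨h, hxU⟩).1
        · exact (hVU₂.ge ⟨h, hxU⟩).1
      · exact (hVU₁.ge ⟨haA, (hε a ha).2⟩).1
      · exact (hVU₂.ge ⟨hbA, (hε b hb).2⟩).1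
    have hwε := hε w (hseg hw)
    have hwA₁ : w ∈ A₁ := (hVU₁.le ⟨hw₁, hwε.2⟩).1
    have hwA₂ : w ∈ A₂ := (hVU₂.le ⟨hw₂, hwε.2⟩).1
    have e₁ := hG₁ ((hε a ha).1.1 haA) (hwε.1.1 hwA₁)
    have e₂ := hG₂ (hwε.1.2 hwA₂) ((hε b hb).1.2 hbA)
    have hd : edist a w + edist w b = edist a b := by
      rw [edist_dist, edist_dist, edist_dist, ← ENNReal.ofReal_add dist_nonneg dist_nonneg,
        dist_add_dist_of_mem_segment hw]
    calc edist (G a) (G b) ≤ edist (G a) (G w) + edist (G w) (G b) := edist_triangle _ _ _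
      _ ≤ C₁ * edist a w + C₂ * edist w b := add_le_add e₁ e₂
      _ ≤ (max C₁ C₂ : NNReal) * edist a w + (max C₁ C₂ : NNReal) * edist w b := by
        gcongr
        · exact le_max_left _ _
        · exact le_max_right _ _
      _ = _ := by rw [← mul_add, hd]
  refine ⟨max C₁ C₂, Metric.ball y ε, Metric.ball_mem_nhds y ε0, fun a ha b hb ↦ ?_⟩
  rcases hc (hε a ha).2 with ha' | ha' <;> rcases hc (hε b hb).2 with hb' | hb'
  · exact (hG₁ ((hε a ha).1.1 ha') ((hε b hb).1.1 hb')).trans (by gcongr; exact le_max_left _ _)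
  · exact key a ha b hb ha' hb'
  · rw [edist_comm, edist_comm a]
    exact key b hb a ha hb' ha'
  · exact (hG₂ ((hε a ha).1.2 ha') ((hε b hb).1.2 hb')).trans (by gcongr; exact le_max_right _ _)

end Euclidean

/-! ### Pullback of bilinear forms -/

section Forms

variable {E : Type*} [NormedAddCommGroup E] [NormedSpace ℝ E]
  {E' : Type*} [NormedAddCommGroup E'] [NormedSpace ℝ E']

/-- The bilinear form `B(A ·, A ·)`. -/
noncomputable def pullbackForm (B : E →L[ℝ] E →L[ℝ] ℝ) (A : E' →L[ℝ] E) : E' →L[ℝ] E' →L[ℝ] ℝ :=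
  ((ContinuousLinearMap.compL ℝ E' E ℝ).flip A).comp (B.comp A)

@[simp]
theorem pullbackForm_apply (B : E →L[ℝ] E →L[ℝ] ℝ) (A : E' →L[ℝ] E) (v w : E') :
    pullbackForm B A v w = B (A v) (A w) := rfl

theorem ContDiffWithinAt.pullbackForm {F : Type*} [NormedAddCommGroup F] [NormedSpace ℝ F]
    {m : WithTop ℕ∞} {S : Set F} {z : F} {B : F → E →L[ℝ] E →L[ℝ] ℝ} {A : F → E' →L[ℝ] E}
    (hB : ContDiffWithinAt ℝ m B S z) (hA : ContDiffWithinAt ℝ m A S z) :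
    ContDiffWithinAt ℝ m (fun y ↦ _root_.pullbackForm (B y) (A y)) S z := by
  have h : ContDiffWithinAt ℝ m (fun y ↦ (ContinuousLinearMap.compL ℝ E' E ℝ).flip (A y)) S z :=
    contDiffWithinAt_const.clm_apply hA
  exact h.clm_comp (hB.clm_comp hA)

end Forms

/-! ### Regularity transported along an immersion of equal dimension -/

section Transfer

variable {E : Type*} [NormedAddCommGroup E] [NormedSpace ℝ E]
  {H : Type*} [TopologicalSpace H] {I : ModelWithCorners ℝ E H}
  {M : Type*} [TopologicalSpace M] [ChartedSpace H M]
  {H' : Type*} [TopologicalSpace H'] {I' : ModelWithCorners ℝ E H'}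
  {M' : Type*} [TopologicalSpace M'] [ChartedSpace H' M'] [IsManifold I' ∞ M']
  {ν ν' : ℕ}

theorem contDiffWithinAt_extChartAt_comp {j : M → M'} {x : M} {y₀ : M'}
    (hj : ContMDiffAt I I' ∞ j x) (hy : j x ∈ (chartAt H' y₀).source) :
    ContDiffWithinAt ℝ ∞ (extChartAt I' y₀ ∘ j ∘ (extChartAt I x).symm) (range I)
      (extChartAt I x x) := by
  rw [← contMDiffWithinAt_iff_contDiffWithinAt]
  exact contMDiffAt_iff_source.1 ((contMDiffAt_iff_target_of_mem_source hy).1 hj).2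

variable [IsManifold I ∞ M]

/-- Both manifolds are modelled on the same finite-dimensional space, so an injective differential
is bijective. -/
theorem isInvertible_fderivWithin_extChartAt_comp [FiniteDimensional ℝ E] {j : M → M'} {x₀ x : M}
    {y₀ : M'} (hj : MDifferentiableAt I I' j x) (hji : Function.Injective (mfderiv I I' j x))
    (hx : x ∈ (chartAt H x₀).source) (hy : j x ∈ (chartAt H' y₀).source) :
    (fderivWithin ℝ (extChartAt I' y₀ ∘ j ∘ (extChartAt I x₀).symm) (range I)
      (extChartAt I x₀ x)).IsInvertible := by
  have hx' : x ∈ (trivializationAt E (TangentSpace I) x₀).baseSet := by simpa using hx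
  have hi : Function.Injective
      (fderivWithin ℝ (extChartAt I' y₀ ∘ j ∘ (extChartAt I x₀).symm) (range I)
        (extChartAt I x₀ x)) := by
    intro u v huv
    have hu := fderivWithin_extChartAt_comp hj hx hy u
    have hv := fderivWithin_extChartAt_comp hj hx hy v
    rw [huv, hv] at hu
    have h := congr((trivializationAt E (TangentSpace I) x₀).continuousLinearMapAt ℝ x $(hji hu))
    rwa [Bundle.Trivialization.continuousLinearMapAt_symmL _ hx',
      Bundle.Trivialization.continuousLinearMapAt_symmL _ hx', eq_comm] at h
  exact ⟨(LinearEquiv.ofInjectiveEndo _ hi).toContinuousLinearEquiv, by ext; rfl⟩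

namespace SemiRiemannianMetric

variable [FiniteDimensional ℝ E]

/-- If `g'` restricts to the smooth metric `g` along an immersion `j` between manifolds of the same
dimension, then the coordinate expression of `g'` pulls back to a smooth function along the
coordinate expression of `j`. -/
theorem AgreesVia.exists_coordForm_comp_eq {g' : SemiRiemannianMetric I' M' ν'} {j : M → M'}
    {g : SemiRiemannianMetric I M ν} (h : g'.AgreesVia j g) (hg : g.SmoothOn univ)
    (hj : ContMDiff I I' ∞ j) (hji : ∀ x, Function.Injective (mfderiv I I' j x)) {x : M} {y₀ : M'}
    (hy : j x ∈ (chartAt H' y₀).source) :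
    ∃ K : E → E →L[ℝ] E →L[ℝ] ℝ, ContDiffWithinAt ℝ ∞ K (range I) (extChartAt I x x) ∧
      ∀ᶠ z in 𝓝[range I] (extChartAt I x x), g'.coordForm y₀
        ((extChartAt I' y₀ ∘ j ∘ (extChartAt I x).symm) z) = K z := by
  set f := extChartAt I' y₀ ∘ j ∘ (extChartAt I x).symm with hf_def
  have hjd : MDifferentiable I I' j := hj.mdifferentiable (by simp)
  have hf := contDiffWithinAt_extChartAt_comp (hj x) hy
  have hz : extChartAt I x x ∈ range I := by simp [extChartAt]
  obtain ⟨A, hA⟩ := isInvertible_fderivWithin_extChartAt_comp (hjd x) (hji x)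
    (mem_chart_source H x) hy
  have hfd : ContDiffWithinAt ℝ ∞ (fderivWithin ℝ f (range I)) (range I) (extChartAt I x x) :=
    hf.fderivWithin_right I.uniqueDiffOn (by simp) hz
  -- `K` is the transformation law solved for the components of `g'`. It is smooth because inversion
  -- of linear maps is smooth at an invertible one.
  refine ⟨fun z ↦ pullbackForm (g.coordForm x z) (fderivWithin ℝ f (range I) z).inverse,
    ContDiffWithinAt.pullbackForm ?_ ?_, ?_⟩
  · exact (g.contMDiffAt_form_iff x).1 (hg.contMDiffAt univ_mem)
  · have hi : ContDiffAt ℝ ∞ (ContinuousLinearMap.inverse : (E →L[ℝ] E) → (E →L[ℝ] E))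
        (fderivWithin ℝ f (range I) (extChartAt I x x)) := hA ▸ contDiffAt_map_inverse A
    exact hi.comp_contDiffWithinAt _ hfd
  · have h₁ : ∀ᶠ z in 𝓝[range I] (extChartAt I x x), z ∈ (extChartAt I x).target :=
      extChartAt_target_mem_nhdsWithin x
    have h₂ : ∀ᶠ z in 𝓝[range I] (extChartAt I x x),
        j ((extChartAt I x).symm z) ∈ (chartAt H' y₀).source := by
      have hc : ContinuousAt (j ∘ (extChartAt I x).symm) (extChartAt I x x) :=
        ContinuousAt.comp (by simpa using hj.continuous.continuousAt)
          (continuousAt_extChartAt_symm x)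
      refine hc.continuousWithinAt.eventually ((chartAt H' y₀).open_source.mem_nhds ?_)
      simpa using hy
    filter_upwards [h₁, h₂] with z hz₁ hz₂
    have hx' : (extChartAt I x).symm z ∈ (chartAt H x).source := by
      simpa using (extChartAt I x).map_target hz₁
    have hzz : extChartAt I x ((extChartAt I x).symm z) = z := (extChartAt I x).right_inv hz₁
    have hD := isInvertible_fderivWithin_extChartAt_comp (hjd _) (hji _) hx' hz₂
    have hc := h.coordForm (hjd ((extChartAt I x).symm z)) hx' hz₂
    rw [hzz, ← hf_def] at hD hc
    ext a b
    rw [pullbackForm_apply, ← hc, hD.self_apply_inverse, hD.self_apply_inverse]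
    rfl

/-- This also covers boundary points, where `f`, the map `j` in charts, is controlled only within
`range I`. As `j` is inducing, `f` maps small neighborhoods within `range I` onto neighborhoods
relative to the image of `j`. -/
theorem AgreesVia.exists_lipschitzOnWith [I'.Boundaryless] {g' : SemiRiemannianMetric I' M' ν'}
    {j : M → M'} {g : SemiRiemannianMetric I M ν} (h : g'.AgreesVia j g) (hg : g.SmoothOn univ)
    (hI : Convex ℝ (range I)) (hj : ContMDiff I I' ∞ j)
    (hji : ∀ x, Function.Injective (mfderiv I I' j x)) (hje : IsInducing j) {x : M} {y₀ : M'}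
    (hy : j x ∈ (chartAt H' y₀).source) :
    ∃ C, ∃ t ∈ 𝓝[(extChartAt I' y₀).symm ⁻¹' range j] (extChartAt I' y₀ (j x)),
      LipschitzOnWith C (g'.coordForm y₀) t := by
  obtain ⟨K, hK, hKf⟩ := h.exists_coordForm_comp_eq hg hj hji hy
  have hjd : MDifferentiable I I' j := hj.mdifferentiable (by simp)
  obtain ⟨A, hA⟩ := isInvertible_fderivWithin_extChartAt_comp (hjd x) (hji x)
    (mem_chart_source H x) hy
  obtain ⟨C, t, ht, hC⟩ := exists_lipschitzOnWith_image
    ((contDiffWithinAt_extChartAt_comp (hj x) hy).of_le (by simp)) hI (by simp [extChartAt])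
    I.uniqueDiffWithinAt_image hA.symm (hK.of_le (by simp)) hKf
  refine ⟨C, _, ?_, hC⟩
  have hys : j x ∈ (extChartAt I' y₀).source := by simpa using hy
  have hyt := (extChartAt I' y₀).map_source hys
  have hN : (chartAt H x).source ∩ extChartAt I x ⁻¹' t ∈ 𝓝 x := by
    refine inter_mem (chart_source_mem_nhds H x) ?_
    have := map_extChartAt_nhds (I := I) x
    rw [← mem_map, this]
    exact ht
  have hjN : j '' ((chartAt H x).source ∩ extChartAt I x ⁻¹' t) ∈ 𝓝[range j] (j x) := by
    rw [← hje.map_nhds_eq]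
    exact image_mem_map hN
  have ht : Tendsto (extChartAt I' y₀).symm
      (𝓝[(extChartAt I' y₀).symm ⁻¹' range j] (extChartAt I' y₀ (j x))) (𝓝[range j] (j x)) := by
    refine tendsto_nhdsWithin_iff.2 ⟨?_, self_mem_nhdsWithin⟩
    have := continuousAt_extChartAt_symm'' hyt
    rw [ContinuousAt, (extChartAt I' y₀).left_inv hys] at this
    exact this.mono_left nhdsWithin_le_nhds
  filter_upwards [ht hjN, mem_nhdsWithin_of_mem_nhds (extChartAt_target_mem_nhds' hyt)]
    with y hy₁ hy₂
  obtain ⟨x', ⟨hx', hx't⟩, hxy⟩ := hy₁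
  refine ⟨_, hx't, ?_⟩
  simp only [Function.comp_apply]
  rw [(extChartAt I x).left_inv (by simpa using hx'), hxy, (extChartAt I' y₀).right_inv hy₂]

/-- At an interior point `range I` is a neighborhood, so derivatives within it are full derivatives
and the inverse function theorem applies. -/
theorem AgreesVia.contMDiffAt_form {g' : SemiRiemannianMetric I' M' ν'} [I'.Boundaryless]
    {j : M → M'} {g : SemiRiemannianMetric I M ν} (h : g'.AgreesVia j g) (hg : g.SmoothOn univ)
    (hj : ContMDiff I I' ∞ j) (hji : ∀ x, Function.Injective (mfderiv I I' j x)) {x : M}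
    (hx : I.IsInteriorPoint x) :
    ContMDiffAt I' (I'.prod 𝓘(ℝ, E →L[ℝ] E →L[ℝ] ℝ)) ∞
      (fun x ↦ Bundle.TotalSpace.mk' (E →L[ℝ] E →L[ℝ] ℝ)
        (E := fun x : M' ↦ TangentSpace I' x →L[ℝ] TangentSpace I' x →L[ℝ] ℝ) x (g'.form x))
      (j x) := by
  have hy := mem_chart_source H' (j x)
  obtain ⟨K, hK, hKf⟩ := h.exists_coordForm_comp_eq hg hj hji hy
  obtain ⟨A, hA⟩ := isInvertible_fderivWithin_extChartAt_comp
    (hj.mdifferentiable (by simp) x) (hji x) (mem_chart_source H x) hy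
  have hS := range_mem_nhds_isInteriorPoint hx
  rw [fderivWithin_of_mem_nhds hS] at hA
  rw [nhdsWithin_eq_nhds.2 hS] at hKf
  rw [contMDiffAt_form_iff]
  have := contDiffAt_of_comp (by simp)
    ((contDiffWithinAt_extChartAt_comp (hj x) hy).contDiffAt hS) hA.symm (hK.contDiffAt hS) hKf
  simpa using this.contDiffWithinAt

/-- A metric which restricts to smooth metrics on two closed subsets covering the manifold is
locally Lipschitz continuous. -/
theorem isLocallyLipschitz_of_agreesVia [I'.Boundaryless] {M₁ M₂ : Type*}
    [TopologicalSpace M₁] [ChartedSpace H M₁] [IsManifold I ∞ M₁]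
    [TopologicalSpace M₂] [ChartedSpace H M₂] [IsManifold I ∞ M₂] (hI : Convex ℝ (range I))
    {ν₁ ν₂ : ℕ}
    {g : SemiRiemannianMetric I' M' ν} {g₁ : SemiRiemannianMetric I M₁ ν₁}
    {g₂ : SemiRiemannianMetric I M₂ ν₂} {j₁ : M₁ → M'} {j₂ : M₂ → M'}
    (h₁ : g.AgreesVia j₁ g₁) (h₂ : g.AgreesVia j₂ g₂)
    (hg₁ : g₁.SmoothOn univ) (hg₂ : g₂.SmoothOn univ)
    (hj₁ : ContMDiff I I' ∞ j₁) (hj₂ : ContMDiff I I' ∞ j₂)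
    (hi₁ : ∀ x, Function.Injective (mfderiv I I' j₁ x))
    (hi₂ : ∀ x, Function.Injective (mfderiv I I' j₂ x))
    (he₁ : IsClosedEmbedding j₁) (he₂ : IsClosedEmbedding j₂)
    (hc : range j₁ ∪ range j₂ = univ) : g.IsLocallyLipschitz := by
  intro x₀ y hy
  have hcont := continuousOn_extChartAt_symm (I := I') x₀
  have hopen := isOpen_extChartAt_target (I := I') x₀
  set S := (extChartAt I' x₀).symm
  have hys : S y ∈ (extChartAt I' x₀).source := (extChartAt I' x₀).map_target hy
  have hyy : extChartAt I' x₀ (S y) = y := (extChartAt I' x₀).right_inv hy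
  have aux : ∀ V : Set M', IsClosed V → ∃ W, IsClosed W ∧
      W ∩ (extChartAt I' x₀).target = S ⁻¹' V ∩ (extChartAt I' x₀).target := fun V hV ↦
    ((continuousOn_iff_isClosed.1 hcont) V hV).imp fun W hW ↦ ⟨hW.1, hW.2.symm⟩
  -- Away from a closed piece, the empty set is a neighborhood relative to this piece, and the
  -- estimate is vacuous.
  have aux₂ : ∀ V : Set M', IsClosed V → S y ∉ V →
      ∃ C, ∃ t ∈ 𝓝[S ⁻¹' V] y, LipschitzOnWith C (g.coordForm x₀) t := by
    intro V hV hyV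
    refine ⟨0, ∅, ?_, by simp⟩
    have := (hcont.continuousAt (hopen.mem_nhds hy)).eventually (hV.isOpen_compl.mem_nhds hyV)
    rw [mem_nhdsWithin_iff_eventually]
    filter_upwards [this] with z hz hz'
    exact hz hz'
  obtain ⟨C, t, ht, hC⟩ := exists_lipschitzOnWith_of_closed_cover
    (G := g.coordForm x₀) (A₁ := S ⁻¹' range j₁) (A₂ := S ⁻¹' range j₂)
    (hopen.mem_nhds hy) (by rw [← preimage_union, hc]; simp)
    (aux _ he₁.isClosed_range) (aux _ he₂.isClosed_range) (by
      by_cases hx : S y ∈ range j₁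
      · obtain ⟨x, hx⟩ := hx
        have := h₁.exists_lipschitzOnWith hg₁ hI hj₁ hi₁ he₁.isInducing (x := x) (y₀ := x₀)
          (by rw [hx]; simpa using hys)
        rwa [hx, hyy] at this
      · exact aux₂ _ he₁.isClosed_range hx) (by
      by_cases hx : S y ∈ range j₂
      · obtain ⟨x, hx⟩ := hx
        have := h₂.exists_lipschitzOnWith hg₂ hI hj₂ hi₂ he₂.isInducing (x := x) (y₀ := x₀)
          (by rw [hx]; simpa using hys)
        rwa [hx, hyy] at this
      · exact aux₂ _ he₂.isClosed_range hx)
  exact ⟨C, t, mem_nhdsWithin_of_mem_nhds ht, hC⟩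

end SemiRiemannianMetric

end Transfer

/-! ### Linear algebra: comparing forms along a hyperplane -/

section Forms

variable {E : Type*} [NormedAddCommGroup E] [NormedSpace ℝ E]
  {E' : Type*} [NormedAddCommGroup E'] [NormedSpace ℝ E']

theorem sigNeg_eq_of_linearEquiv {B : E →L[ℝ] E →L[ℝ] ℝ} {B' : E' →L[ℝ] E' →L[ℝ] ℝ}
    (A : E ≃ₗ[ℝ] E') (h : ∀ v w, B' (A v) (A w) = B v w) :
    sigNeg (LinearMap.BilinMap.toQuadraticMap
      ((ContinuousLinearMap.coeLM ℝ).comp B'.toLinearMap)) =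
    sigNeg (LinearMap.BilinMap.toQuadraticMap
      ((ContinuousLinearMap.coeLM ℝ).comp B.toLinearMap)) :=
  (QuadraticMap.Equivalent.sigNeg_eq ⟨⟨A, fun v ↦ h v v⟩⟩).symm

/-- Two symmetric bilinear forms on spaces mapped to a common one by `D` and `D'` take the same
values on vectors with the same image, if they do so on a hyperplane and on pairs containing a fixed
vector outside this hyperplane. -/
theorem form_eq_of_eq_on_hyperplane {F : Type*} [NormedAddCommGroup F] [NormedSpace ℝ F]
    {B : E →L[ℝ] E →L[ℝ] ℝ} {B' : E' →L[ℝ] E' →L[ℝ] ℝ}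
    (hB : ∀ v w, B v w = B w v) (hB' : ∀ v w, B' v w = B' w v) {D : E →L[ℝ] F} {D' : E' →L[ℝ] F}
    (hD' : Function.Injective D') (l : E →L[ℝ] ℝ) {T : E → E'} (hT : ∀ v, l v = 0 → D' (T v) = D v)
    {ξ : E} {η : E'} (hξ : l ξ ≠ 0) (hη : D' η = D ξ)
    (h : ∀ v, l v = 0 → ∀ w, l w = 0 → B v w = B' (T v) (T w))
    (hv : ∀ v, l v = 0 → B ξ v = B' η (T v)) (hξξ : B ξ ξ = B' η η) {v w : E} {v' w' : E'}
    (hvv' : D' v' = D v) (hww' : D' w' = D w) : B v w = B' v' w' := by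
  -- Split `u` along `ξ` and `ker l`. Injectivity of `D'` forces the corresponding splitting of `u'`
  -- along `η` and `T u₀`, with the same coefficient.
  have key : ∀ (u : E) (u' : E'), D' u' = D u →
      ∃ a : ℝ, ∃ u₀ : E, l u₀ = 0 ∧ u = a • ξ + u₀ ∧ u' = a • η + T u₀ := by
    intro u u' hu
    have h0 : l (u - (l u / l ξ) • ξ) = 0 := by simp [hξ]
    refine ⟨l u / l ξ, u - (l u / l ξ) • ξ, h0, by simp, hD' ?_⟩
    rw [map_add, hT _ h0, hu, map_smul, hη]
    simp
  obtain ⟨a, v₀, hv₀, rfl, rfl⟩ := key v v' hvv'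
  obtain ⟨b, w₀, hw₀, rfl, rfl⟩ := key w w' hww'
  simp only [map_add, map_smul, add_apply, smul_apply,
    h _ hv₀ _ hw₀, hv _ hw₀, hB v₀ ξ, hB' (T v₀) η, hv _ hv₀, hξξ]

end Forms

/-! ### Vectors tangent to the boundary -/

section BoundaryTangent

variable {n : ℕ} [NeZero n]
  {M : Type*} [TopologicalSpace M] [ChartedSpace (EuclideanHalfSpace n) M]
  [IsManifold (𝓡∂ n) ∞ M]

/-- Boundary points can be detected in any chart of the atlas, here the one around `p`; its target
lies in the half space, whose interior is `0 < z 0`. -/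
theorem mem_boundary_of_extChartAt_symm {p : M} {z : EuclideanSpace ℝ (Fin n)}
    (hz : z ∈ (extChartAt (𝓡∂ n) p).target) (hz0 : z 0 = 0) :
    (extChartAt (𝓡∂ n) p).symm z ∈ (𝓡∂ n).boundary M := by
  have hs : (extChartAt (𝓡∂ n) p).symm z ∈ (chartAt (EuclideanHalfSpace n) p).source := by
    simpa using (extChartAt (𝓡∂ n) p).map_target hz
  refine (ModelWithCorners.isBoundaryPoint_iff_of_mem_atlas (n := ∞) (by simp)
    (chart_mem_atlas _ p) hs).2 ?_
  change extChartAt (𝓡∂ n) p ((extChartAt (𝓡∂ n) p).symm z) ∈ frontier (extChartAt (𝓡∂ n) p).target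
  rw [(extChartAt (𝓡∂ n) p).right_inv hz]
  refine ⟨subset_closure hz, fun hi ↦ ?_⟩
  have := interior_mono (extChartAt_target_subset_range (I := 𝓡∂ n) p) hi
  rw [interior_range_modelWithCornersEuclideanHalfSpace] at this
  exact this.ne' hz0

/-- In the chart at `p` the line through the image of `p` in direction `v` stays in the hyperplane
`z 0 = 0`, hence in the boundary for small parameters. -/
theorem mem_tangentConeAt_of_mem_boundaryTangentSpace {p : M} (hp : p ∈ (𝓡∂ n).boundary M)
    {v : EuclideanSpace ℝ (Fin n)} (hv : v 0 = 0) :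
    v ∈ tangentConeAt ℝ ((extChartAt (𝓡∂ n) p).symm ⁻¹' (𝓡∂ n).boundary M ∩ range (𝓡∂ n))
      (extChartAt (𝓡∂ n) p p) := by
  have hp0 : extChartAt (𝓡∂ n) p p 0 = 0 := by
    have : extChartAt (𝓡∂ n) p p ∈ frontier (range (𝓡∂ n)) := hp
    rw [frontier_range_modelWithCornersEuclideanHalfSpace] at this
    exact this.symm
  have h0 : ∀ c : ℝ, (extChartAt (𝓡∂ n) p p + c • v) 0 = 0 := fun c ↦ by
    rw [PiLp.add_apply, PiLp.smul_apply, hp0, hv, smul_zero, add_zero]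
  have hr : ∀ c : ℝ, extChartAt (𝓡∂ n) p p + c • v ∈ range (𝓡∂ n) := fun c ↦ by
    rw [range_modelWithCornersEuclideanHalfSpace]
    exact (h0 c).ge
  have ht : Tendsto (fun c : ℝ ↦ extChartAt (𝓡∂ n) p p + c • v) (𝓝[≠] 0)
      (𝓝[range (𝓡∂ n)] (extChartAt (𝓡∂ n) p p)) := by
    refine tendsto_nhdsWithin_iff.2 ⟨?_, Eventually.of_forall hr⟩
    have : Continuous fun c : ℝ ↦ extChartAt (𝓡∂ n) p p + c • v := by fun_prop
    simpa using (this.tendsto 0).mono_left nhdsWithin_le_nhds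
  refine mem_tangentConeAt_of_add_smul_mem tendsto_id ?_
  filter_upwards [ht (extChartAt_target_mem_nhdsWithin p)] with c hc
  exact ⟨mem_boundary_of_extChartAt_symm hc (h0 c), hr c⟩

/-- The derivative within the boundary is determined on vectors tangent to the boundary. -/
theorem HasMFDerivWithinAt.eq_on_boundaryTangentSpace {E' : Type*} [NormedAddCommGroup E']
    [NormedSpace ℝ E'] {H' : Type*} [TopologicalSpace H'] {I' : ModelWithCorners ℝ E' H'}
    {M' : Type*} [TopologicalSpace M'] [ChartedSpace H' M'] {f : M → M'} {p : M}
    {D D' : EuclideanSpace ℝ (Fin n) →L[ℝ] E'} (hp : p ∈ (𝓡∂ n).boundary M)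
    (h : HasMFDerivWithinAt (𝓡∂ n) I' f ((𝓡∂ n).boundary M) p D)
    (h' : HasMFDerivWithinAt (𝓡∂ n) I' f ((𝓡∂ n).boundary M) p D')
    {v : EuclideanSpace ℝ (Fin n)} (hv : v 0 = 0) : D v = D' v :=
  HasFDerivWithinAt.unique_on (f' := D) (f₁' := D') h.2 h'.2
    (mem_tangentConeAt_of_mem_boundaryTangentSpace hp hv)

end BoundaryTangent

/-! ### Points of the adjunction space -/

namespace AdjunctionSpace

variable {M₁ M₂ : Type*} {φ : PartialEquiv M₁ M₂}

theorem inl_eq_inr {x : M₁} (hx : x ∈ φ.source) : inl φ x = inr φ (φ x) :=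
  Quot.sound ⟨x, hx, rfl, rfl⟩

theorem inl_eq_inr_iff {x : M₁} {y : M₂} : inl φ x = inr φ y ↔ x ∈ φ.source ∧ y = φ x := by
  refine ⟨fun h ↦ ?_, fun h ↦ h.2 ▸ inl_eq_inr h.1⟩
  -- `P` describes the expected equivalence class of `x`. It descends to the quotient because `φ` is
  -- injective on its source.
  let P : AdjunctionSpace φ → Prop :=
    Quot.lift (Sum.elim (fun x' ↦ x' = x) (fun y' ↦ x ∈ φ.source ∧ y' = φ x)) (by
      rintro _ _ ⟨x', hx', rfl, rfl⟩
      refine propext ⟨?_, fun h ↦ φ.injOn hx' h.1 h.2⟩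
      rintro rfl
      exact ⟨hx', rfl⟩)
  have hP : P (inl φ x) := rfl
  rwa [h] at hP

theorem exists_eq (q : AdjunctionSpace φ) : (∃ x, inl φ x = q) ∨ ∃ y, inr φ y = q := by
  induction q using Quot.ind with
  | mk a =>
    cases a with
    | inl x => exact Or.inl ⟨x, rfl⟩
    | inr y => exact Or.inr ⟨y, rfl⟩

theorem inr_mem_seam {y : M₂} (hy : y ∈ φ.target) : inr φ y ∈ seam φ :=
  ⟨φ.symm y, φ.map_target hy, by rw [inl_eq_inr (φ.map_target hy), φ.right_inv hy]⟩

end AdjunctionSpace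

/-! ### Agreement of the two metrics on the seam -/

section Gluing

variable {n : ℕ} [NeZero n]
  {M₁ : Type*} [TopologicalSpace M₁] [ChartedSpace (EuclideanHalfSpace n) M₁]
  [IsManifold (𝓡∂ n) ∞ M₁]
  {M₂ : Type*} [TopologicalSpace M₂] [ChartedSpace (EuclideanHalfSpace n) M₂]

theorem IsRegularDomainEmbedding.mdifferentiable {N : Type*} [TopologicalSpace N]
    [ChartedSpace (EuclideanSpace ℝ (Fin n)) N] {j : M₂ → N}
    (hj : IsRegularDomainEmbedding n j) : MDifferentiable (𝓡∂ n) (𝓡 n) j :=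
  hj.contMDiff.mdifferentiable (by simp)

theorem IsRegularDomainEmbedding.exists_equiv_mfderiv {N : Type*} [TopologicalSpace N]
    [ChartedSpace (EuclideanSpace ℝ (Fin n)) N] {j : M₂ → N}
    (hj : IsRegularDomainEmbedding n j) (p : M₂) :
    ∃ A : EuclideanSpace ℝ (Fin n) ≃L[ℝ] EuclideanSpace ℝ (Fin n),
      ∀ v : EuclideanSpace ℝ (Fin n), A v = mfderiv (𝓡∂ n) (𝓡 n) j p v := by
  obtain ⟨D, hD⟩ : ∃ D : EuclideanSpace ℝ (Fin n) →L[ℝ] EuclideanSpace ℝ (Fin n),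
    D = mfderiv (𝓡∂ n) (𝓡 n) j p := ⟨_, rfl⟩
  have hi : Function.Injective D := hD ▸ hj.injective_mfderiv p
  exact ⟨(LinearEquiv.ofInjectiveEndo (D : _ →ₗ[ℝ] _) hi).toContinuousLinearEquiv,
    fun v ↦ hD ▸ rfl⟩

/-- Differentiate `inl = inr ∘ φ` along the boundary. A derivative within the boundary is not unique
in transversal directions, hence the restriction to tangent vectors. -/
theorem mfderiv_inr_mfderivWithin {φ : PartialEquiv M₁ M₂}
    [ChartedSpace (EuclideanSpace ℝ (Fin n)) (AdjunctionSpace φ)]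
    [IsManifold (𝓡 n) ∞ (AdjunctionSpace φ)]
    (hM : IsGluedSmoothStructure (n := n) φ) (hφ : IsBoundaryDiffeo n φ) {p : M₁}
    (hp : p ∈ (𝓡∂ n).boundary M₁) {v : EuclideanSpace ℝ (Fin n)} (hv : v 0 = 0) :
    (mfderiv (𝓡∂ n) (𝓡 n) (AdjunctionSpace.inr φ) (φ p)
      (mfderivWithin (𝓡∂ n) (𝓡∂ n) φ ((𝓡∂ n).boundary M₁) p v) : EuclideanSpace ℝ (Fin n)) =
    mfderiv (𝓡∂ n) (𝓡 n) (AdjunctionSpace.inl φ) p v := by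
  have h₁ : HasMFDerivWithinAt (𝓡∂ n) (𝓡∂ n) φ ((𝓡∂ n).boundary M₁) p _ :=
    ((hφ.contMDiffOn p hp).mdifferentiableWithinAt (by simp)).hasMFDerivWithinAt
  have h₂ := (hM.inr.mdifferentiable (φ p)).hasMFDerivAt.comp_hasMFDerivWithinAt p h₁
  have h₃ := ((hM.inl.mdifferentiable p).hasMFDerivAt.hasMFDerivWithinAt
    (s := (𝓡∂ n).boundary M₁))
  have h₄ := h₂.congr_of_eventuallyEq (f₁ := AdjunctionSpace.inl φ) (by
      filter_upwards [self_mem_nhdsWithin] with x hx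
      exact AdjunctionSpace.inl_eq_inr (hφ.source_eq ▸ hx))
    (AdjunctionSpace.inl_eq_inr (hφ.source_eq ▸ hp))
  exact HasMFDerivWithinAt.eq_on_boundaryTangentSpace hp h₄ h₃ hv

/-- The metrics on both sides agree at the common boundary. -/
theorem IsAligningIsometry.form_eq {ν₁ ν₂ : ℕ}
    {g₁ : SemiRiemannianMetric (𝓡∂ n) M₁ ν₁} {g₂ : SemiRiemannianMetric (𝓡∂ n) M₂ ν₂}
    {φ : PartialEquiv M₁ M₂} [ChartedSpace (EuclideanSpace ℝ (Fin n)) (AdjunctionSpace φ)]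
    [IsManifold (𝓡 n) ∞ (AdjunctionSpace φ)]
    (hM : IsGluedSmoothStructure (n := n) φ) {ξ : ∀ p : M₁, TangentSpace (𝓡∂ n) p}
    (hφ : IsAligningIsometry g₁ g₂ φ ξ) {p : M₁} (hp : p ∈ (𝓡∂ n).boundary M₁)
    {v w v' w' : EuclideanSpace ℝ (Fin n)}
    (hv : (mfderiv (𝓡∂ n) (𝓡 n) (AdjunctionSpace.inr φ) (φ p) v' : EuclideanSpace ℝ (Fin n)) =
      mfderiv (𝓡∂ n) (𝓡 n) (AdjunctionSpace.inl φ) p v)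
    (hw : (mfderiv (𝓡∂ n) (𝓡 n) (AdjunctionSpace.inr φ) (φ p) w' : EuclideanSpace ℝ (Fin n)) =
      mfderiv (𝓡∂ n) (𝓡 n) (AdjunctionSpace.inl φ) p w) :
    g₁.form p v w = g₂.form (φ p) v' w' := by
  obtain ⟨η, hη, hηv, hηη⟩ := hφ.aligning p hp
  exact form_eq_of_eq_on_hyperplane (E := EuclideanSpace ℝ (Fin n))
    (E' := EuclideanSpace ℝ (Fin n)) (F := EuclideanSpace ℝ (Fin n)) (g₁.symm p) (g₂.symm (φ p))
    (D := mfderiv (𝓡∂ n) (𝓡 n) (AdjunctionSpace.inl φ) p)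
    (D' := mfderiv (𝓡∂ n) (𝓡 n) (AdjunctionSpace.inr φ) (φ p))
    (hM.inr.injective_mfderiv (φ p)) (EuclideanSpace.proj (0 : Fin n))
    (T := mfderivWithin (𝓡∂ n) (𝓡∂ n) φ ((𝓡∂ n).boundary M₁) p)
    (fun u hu ↦ mfderiv_inr_mfderivWithin hM hφ.isBoundaryDiffeo hp hu)
    -- `hη` is an equality in the tangent bundle over two expressions for one point; both fibers are
    -- the model space, so its second components are equal vectors.
    (hφ.isTransversalField.transversal p hp) (eq_of_heq (Bundle.TotalSpace.mk.inj hη).2)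
    (hφ.isometry p hp) hηv hηη hv hw

end Gluing

/-! ### The glued form and its uniqueness -/

section Gluing

variable {n : ℕ} [NeZero n]
  {M₁ : Type*} [TopologicalSpace M₁] [ChartedSpace (EuclideanHalfSpace n) M₁]
  [IsManifold (𝓡∂ n) ∞ M₁]
  {M₂ : Type*} [TopologicalSpace M₂] [ChartedSpace (EuclideanHalfSpace n) M₂]

/-- The push-forward of the metric on the tangent space at a point under an embedding onto a regular
domain. -/
theorem IsRegularDomainEmbedding.exists_form {N : Type*} [TopologicalSpace N]
    [ChartedSpace (EuclideanSpace ℝ (Fin n)) N] {j : M₂ → N}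
    (hj : IsRegularDomainEmbedding n j) {ν : ℕ} (g : SemiRiemannianMetric (𝓡∂ n) M₂ ν) (p : M₂) :
    ∃ B : EuclideanSpace ℝ (Fin n) →L[ℝ] EuclideanSpace ℝ (Fin n) →L[ℝ] ℝ,
      ∀ v w : EuclideanSpace ℝ (Fin n),
        B (mfderiv (𝓡∂ n) (𝓡 n) j p v) (mfderiv (𝓡∂ n) (𝓡 n) j p w) = g.form p v w := by
  obtain ⟨A, hA⟩ := hj.exists_equiv_mfderiv p
  refine ⟨pullbackForm (E := EuclideanSpace ℝ (Fin n)) (g.form p) A.symm, fun v w ↦ ?_⟩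
  have hv : A.symm (mfderiv (𝓡∂ n) (𝓡 n) j p v) = v := A.symm_apply_eq.2 (hA v).symm
  have hw : A.symm (mfderiv (𝓡∂ n) (𝓡 n) j p w) = w := A.symm_apply_eq.2 (hA w).symm
  exact congrArg₂ (fun a b : EuclideanSpace ℝ (Fin n) ↦ g.form p a b) hv hw

/-- The algebraic properties of a metric are inherited by a bilinear form which it is the pull-back
of. -/
theorem IsRegularDomainEmbedding.form_properties {N : Type*} [TopologicalSpace N]
    [ChartedSpace (EuclideanSpace ℝ (Fin n)) N] {j : M₂ → N}
    (hj : IsRegularDomainEmbedding n j) {ν : ℕ} (g : SemiRiemannianMetric (𝓡∂ n) M₂ ν) (p : M₂)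
    {B : EuclideanSpace ℝ (Fin n) →L[ℝ] EuclideanSpace ℝ (Fin n) →L[ℝ] ℝ}
    (hB : ∀ v w : EuclideanSpace ℝ (Fin n),
        B (mfderiv (𝓡∂ n) (𝓡 n) j p v) (mfderiv (𝓡∂ n) (𝓡 n) j p w) = g.form p v w) :
    (∀ v w, B v w = B w v) ∧ (∀ v, (∀ w, B v w = 0) → v = 0) ∧
      sigNeg (LinearMap.BilinMap.toQuadraticMap
        ((ContinuousLinearMap.coeLM ℝ).comp B.toLinearMap)) = ν := by
  obtain ⟨A, hA⟩ := hj.exists_equiv_mfderiv p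
  have hB' : ∀ v w, B (A v) (A w) = g.form p v w := fun v w ↦ by
    rw [hA, hA]
    exact hB v w
  refine ⟨fun v w ↦ ?_, fun v hv ↦ ?_, ?_⟩
  · obtain ⟨v, rfl⟩ := A.surjective v
    obtain ⟨w, rfl⟩ := A.surjective w
    exact (hB' v w).trans ((g.symm p v w).trans (hB' w v).symm)
  · obtain ⟨v, rfl⟩ := A.surjective v
    have h0 : v = 0 := g.nondegenerate p v fun w ↦ (hB' v w).symm.trans (hv (A w))
    rw [h0, map_zero]
  · have key : ∀ B' : EuclideanSpace ℝ (Fin n) →L[ℝ] EuclideanSpace ℝ (Fin n) →L[ℝ] ℝ,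
        (∀ v w, B (A v) (A w) = B' v w) → sigNeg (LinearMap.BilinMap.toQuadraticMap
          ((ContinuousLinearMap.coeLM ℝ).comp B'.toLinearMap)) = ν →
        sigNeg (LinearMap.BilinMap.toQuadraticMap
          ((ContinuousLinearMap.coeLM ℝ).comp B.toLinearMap)) = ν :=
      fun B' h h' ↦ (sigNeg_eq_of_linearEquiv A.toLinearEquiv h).trans h'
    exact key (g.form p) hB' (g.index_eq p)

/-- The glued bilinear form at a point of the adjunction space. -/
theorem exists_glued_form {ν : ℕ}
    {g₁ : SemiRiemannianMetric (𝓡∂ n) M₁ ν} {g₂ : SemiRiemannianMetric (𝓡∂ n) M₂ ν}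
    {φ : PartialEquiv M₁ M₂} [ChartedSpace (EuclideanSpace ℝ (Fin n)) (AdjunctionSpace φ)]
    [IsManifold (𝓡 n) ∞ (AdjunctionSpace φ)]
    (hM : IsGluedSmoothStructure (n := n) φ) {ξ : ∀ p : M₁, TangentSpace (𝓡∂ n) p}
    (hφ : IsAligningIsometry g₁ g₂ φ ξ) (q : AdjunctionSpace φ) :
    ∃ B : EuclideanSpace ℝ (Fin n) →L[ℝ] EuclideanSpace ℝ (Fin n) →L[ℝ] ℝ,
      (∀ p, AdjunctionSpace.inl φ p = q → ∀ v w : EuclideanSpace ℝ (Fin n),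
        B (mfderiv (𝓡∂ n) (𝓡 n) (AdjunctionSpace.inl φ) p v)
          (mfderiv (𝓡∂ n) (𝓡 n) (AdjunctionSpace.inl φ) p w) = g₁.form p v w) ∧
      (∀ p, AdjunctionSpace.inr φ p = q → ∀ v w : EuclideanSpace ℝ (Fin n),
        B (mfderiv (𝓡∂ n) (𝓡 n) (AdjunctionSpace.inr φ) p v)
          (mfderiv (𝓡∂ n) (𝓡 n) (AdjunctionSpace.inr φ) p w) = g₂.form p v w) := by
  by_cases hq : ∃ p, AdjunctionSpace.inl φ p = q
  · obtain ⟨p, rfl⟩ := hq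
    obtain ⟨B, hB⟩ := hM.inl.exists_form g₁ p
    refine ⟨B, fun p' hp' ↦ ?_, fun p' hp' v' w' ↦ ?_⟩
    · obtain rfl := hM.inl.isEmbedding.injective hp'
      exact hB
    · obtain ⟨hp, rfl⟩ := AdjunctionSpace.inl_eq_inr_iff.1 hp'.symm
      -- On the seam `B` comes from the first side. Every vector coming from the second side is also
      -- the image of one from the first, so the two metrics can be compared there.
      obtain ⟨A, hA⟩ := hM.inl.exists_equiv_mfderiv p
      obtain ⟨v, hv⟩ := A.surjective (mfderiv (𝓡∂ n) (𝓡 n) (AdjunctionSpace.inr φ) (φ p) v')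
      obtain ⟨w, hw⟩ := A.surjective (mfderiv (𝓡∂ n) (𝓡 n) (AdjunctionSpace.inr φ) (φ p) w')
      rw [hA] at hv hw
      refine Eq.trans ?_ (hφ.form_eq hM (hφ.isBoundaryDiffeo.source_eq ▸ hp) hv.symm hw.symm)
      refine Eq.trans ?_ (hB v w)
      exact congrArg₂ (fun a b : EuclideanSpace ℝ (Fin n) ↦ B a b) hv.symm hw.symm
  · obtain ⟨p, rfl⟩ := (AdjunctionSpace.exists_eq q).resolve_left hq
    obtain ⟨B, hB⟩ := hM.inr.exists_form g₂ p
    refine ⟨B, fun p' hp' ↦ (hq ⟨p', hp'⟩).elim, fun p' hp' ↦ ?_⟩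
    obtain rfl := hM.inr.isEmbedding.injective hp'
    exact hB

/-- A metric is determined at the points of a regular domain by its restriction to this domain. -/
theorem SemiRiemannianMetric.AgreesVia.form_eq {N : Type*} [TopologicalSpace N]
    [ChartedSpace (EuclideanSpace ℝ (Fin n)) N] {j : M₂ → N}
    (hj : IsRegularDomainEmbedding n j) {ν ν' : ℕ} {g : SemiRiemannianMetric (𝓡∂ n) M₂ ν}
    {g' g'' : SemiRiemannianMetric (𝓡 n) N ν'} (h' : g'.AgreesVia j g) (h'' : g''.AgreesVia j g)
    (p : M₂) : g'.form (j p) = g''.form (j p) := by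
  obtain ⟨A, hA⟩ := hj.exists_equiv_mfderiv p
  have key : ∀ v w : EuclideanSpace ℝ (Fin n), g'.form (j p) v w = g''.form (j p) v w := by
    intro v w
    obtain ⟨v, rfl⟩ := A.surjective v
    obtain ⟨w, rfl⟩ := A.surjective w
    rw [hA, hA]
    exact (h' p v w).trans (h'' p v w).symm
  exact ContinuousLinearMap.ext fun v ↦ ContinuousLinearMap.ext fun w ↦ key v w

end Gluing

/-! ### The matching theorem -/

theorem mainTheorem4 {n : ℕ} [NeZero n]
    {M₁ : Type*} [TopologicalSpace M₁] [T2Space M₁] [SecondCountableTopology M₁]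
    [ChartedSpace (EuclideanHalfSpace n) M₁] [IsManifold (𝓡∂ n) ∞ M₁]
    {M₂ : Type*} [TopologicalSpace M₂] [T2Space M₂] [SecondCountableTopology M₂]
    [ChartedSpace (EuclideanHalfSpace n) M₂] [IsManifold (𝓡∂ n) ∞ M₂]
    (hM₁ : ((𝓡∂ n).boundary M₁).Nonempty) (hM₂ : ((𝓡∂ n).boundary M₂).Nonempty)
    {ν : ℕ}
    (g₁ : SemiRiemannianMetric (𝓡∂ n) M₁ ν) (hg₁ : g₁.SmoothOn Set.univ)
    (g₂ : SemiRiemannianMetric (𝓡∂ n) M₂ ν) (hg₂ : g₂.SmoothOn Set.univ)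
    (φ : PartialEquiv M₁ M₂)
    [ChartedSpace (EuclideanSpace ℝ (Fin n)) (AdjunctionSpace φ)]
    [IsManifold (𝓡 n) ∞ (AdjunctionSpace φ)]
    (hM : IsGluedSmoothStructure (n := n) φ)
    (ξ : ∀ p : M₁, TangentSpace (𝓡∂ n) p)
    (hφ : IsAligningIsometry g₁ g₂ φ ξ) :
    ∃ g : SemiRiemannianMetric (𝓡 n) (AdjunctionSpace φ) ν,
      (g.IsLocallyLipschitz ∧
        g.AgreesVia (AdjunctionSpace.inl φ) g₁ ∧ g.AgreesVia (AdjunctionSpace.inr φ) g₂) ∧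
      g.SmoothOn (AdjunctionSpace.seam φ)ᶜ ∧
      ∀ g' : SemiRiemannianMetric (𝓡 n) (AdjunctionSpace φ) ν,
        (g'.IsLocallyLipschitz ∧
          g'.AgreesVia (AdjunctionSpace.inl φ) g₁ ∧ g'.AgreesVia (AdjunctionSpace.inr φ) g₂) →
        g' = g := by
  choose B hB₁ hB₂ using exists_glued_form hM hφ
  have hB : ∀ q, (∀ v w, B q v w = B q w v) ∧ (∀ v, (∀ w, B q v w = 0) → v = 0) ∧
      sigNeg (LinearMap.BilinMap.toQuadraticMap
        ((ContinuousLinearMap.coeLM ℝ).comp (B q).toLinearMap)) = ν := by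
    intro q
    rcases AdjunctionSpace.exists_eq q with ⟨p, hp⟩ | ⟨p, hp⟩
    · exact hM.inl.form_properties g₁ p (hB₁ q p hp)
    · exact hM.inr.form_properties g₂ p (hB₂ q p hp)
  let g : SemiRiemannianMetric (𝓡 n) (AdjunctionSpace φ) ν :=
    { form := B
      symm := fun q ↦ (hB q).1
      nondegenerate := fun q ↦ (hB q).2.1
      index_eq := fun q ↦ (hB q).2.2 }
  have hl : g.AgreesVia (AdjunctionSpace.inl φ) g₁ := fun p ↦ hB₁ _ p rfl
  have hr : g.AgreesVia (AdjunctionSpace.inr φ) g₂ := fun p ↦ hB₂ _ p rfl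
  refine ⟨g, ⟨?_, hl, hr⟩, ?_, ?_⟩
  · refine SemiRiemannianMetric.isLocallyLipschitz_of_agreesVia ?_ hl hr hg₁ hg₂ hM.inl.contMDiff
      hM.inr.contMDiff hM.inl.injective_mfderiv hM.inr.injective_mfderiv
      ⟨hM.inl.isEmbedding, hM.inl.isProperMap.isClosedMap.isClosed_range⟩
      ⟨hM.inr.isEmbedding, hM.inr.isProperMap.isClosedMap.isClosed_range⟩
      (eq_univ_of_forall AdjunctionSpace.exists_eq)
    exact (𝓡∂ n).convex_range
  · intro q hq
    refine ContMDiffAt.contMDiffWithinAt ?_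
    rcases AdjunctionSpace.exists_eq q with ⟨p, rfl⟩ | ⟨p, rfl⟩
    · refine hl.contMDiffAt_form hg₁ hM.inl.contMDiff hM.inl.injective_mfderiv ?_
      rw [ModelWithCorners.isInteriorPoint_iff_not_isBoundaryPoint]
      intro hp
      exact hq ⟨p, hφ.isBoundaryDiffeo.source_eq.ge hp, rfl⟩
    · refine hr.contMDiffAt_form hg₂ hM.inr.contMDiff hM.inr.injective_mfderiv ?_
      rw [ModelWithCorners.isInteriorPoint_iff_not_isBoundaryPoint]
      intro hp
      exact hq (AdjunctionSpace.inr_mem_seam (hφ.isBoundaryDiffeo.target_eq.ge hp))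
  · rintro g' ⟨-, hl', hr'⟩
    ext q : 2
    rcases AdjunctionSpace.exists_eq q with ⟨p, rfl⟩ | ⟨p, rfl⟩
    · exact hl'.form_eq hM.inl hl p
    · exact hr'.form_eq hM.inr hr p
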